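/- Let $(M,h)$ be a Riemannian surface (a smooth Riemannian manifold of dimension $2$, without boundary) and let $(N,g)$ be a smooth Riemannian manifold of arbitrary finite dimension. Let $\delta_1,\delta_2\in\mathbb{R}$ with $\delta_2\neq 0$, and let $\phi\colon M\to N$ be a smooth map. Denote by $\tau(\phi)=\operatorname{Tr}_h\nabla d\phi$ the tension field of $\phi$ and by $\nabla$ also the connection on $\phi^*TN$ induced by the Levi-Civita connection of $(N,g)$. The energy-momentum tensor of $\phi$ for the functional $$E_{\delta_1,\delta_2}(\phi)=\delta_1\int_M|d\phi|^2\,dV+\delta_2\int_M|\tau(\phi)|^2\,dV$$ is $$\begin{aligned}T(X,Y)=\;&\delta_1\Big(\langle d\phi(X),d\phi(Y)\rangle-\tfrac12|d\phi|^2h(X,Y)\Big)\\&+\delta_2\Big(\tfrac12|\tau(\phi)|^2h(X,Y)+\langle d\phi,\nabla\tau(\phi)\rangle h(X,Y)-\langle d\phi(X),\nabla_Y\tau(\phi)\rangle-\langle d\phi(Y),\nabla_X\tau(\phi)\rangle\Big),\end{aligned}$$ where $\langle d\phi,\nabla\tau(\phi)\rangle=\sum_\alpha\langle d\phi(e_\alpha),\nabla_{e_\alpha}\tau(\phi)\rangle$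 for a local orthonormal frame $(e_\alpha)$ of $TM$. If $T(X,Y)=0$ for all tangent vectors $X,Y\in T_xM$ at every point $x\in M$, then $\phi$ is harmonic, that is, $\tau(\phi)=0$ on $M$. -/

import Mathlib

open scoped Manifold ContDiff

noncomputable section

namespace SemiBiharmonic

/-- A smooth Riemannian metric on a manifold of dimension `m` (without boundary). -/
abbrev Metric (m : ℕ) (M : Type*) [TopologicalSpace M] [ChartedSpace (EuclideanSpace ℝ (Fin m)) M]
    [IsManifold (𝓡 m) ∞ M] : Type _ :=
  Bundle.ContMDiffRiemannianMetric (𝓡 m) ∞ (EuclideanSpace ℝ (Fin m))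
    (fun x : M => TangentSpace (𝓡 m) x)

section Coordinates

variable {m : ℕ} {M : Type*} [TopologicalSpace M] [ChartedSpace (EuclideanSpace ℝ (Fin m)) M]

/-- The `i`-th component of the tangent vector `X ∈ T_y M` in the chart around `p`, that is
`dx^i(X)`, where `x^1, …, x^m` are the coordinates of that chart. -/
def comp (p y : M) (X : TangentSpace (𝓡 m) y) (i : Fin m) : ℝ :=
  mvfderiv (𝓡 m) (fun z : M => extChartAt (𝓡 m) p z) y X i

/-- The coordinate vector `∂_i ∈ T_y M` of the chart around `p`: the differential of the chart
at `y` sends it to the `i`-th standard basis vector. -/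
def coordVec (p y : M) (i : Fin m) : TangentSpace (𝓡 m) y :=
  (mvfderiv (𝓡 m) (fun z : M => extChartAt (𝓡 m) p z) y).inverse (EuclideanSpace.single i 1)

/-- The partial derivative `∂_i f` at `y` of a function on `M`, in the chart around `p`. -/
def partialDeriv (p : M) (f : M → ℝ) (y : M) (i : Fin m) : ℝ :=
  mvfderiv (𝓡 m) f y (coordVec p y i)

variable [IsManifold (𝓡 m) ∞ M]

/-- The matrix `h_{ij} = h(∂_i, ∂_j)` at `y` in the chart around `p`. -/
def gram (h : Metric m M) (p y : M) : Matrix (Fin m) (Fin m) ℝ :=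
  Matrix.of fun i j => h.inner y (coordVec p y i) (coordVec p y j)

/-- The Christoffel symbol of the Levi-Civita connection of `h` at `y` in the chart around `p`,
`Γ^k_{ij} = ½ h^{kl} (∂_i h_{jl} + ∂_j h_{il} - ∂_l h_{ij})`. -/
def christoffel (h : Metric m M) (p y : M) (k i j : Fin m) : ℝ :=
  (1 / 2) * ∑ l, (gram h p y)⁻¹ k l *
    (partialDeriv p (fun z => gram h p z j l) y i + partialDeriv p (fun z => gram h p z i l) y j
      - partialDeriv p (fun z => gram h p z i j) y l)

/-- The trace with respect to `h` of a bilinear expression `B` on `T_x M`, given by its values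
`B i j = B(∂_i, ∂_j)`: the sum `h^{ij} B(∂_i, ∂_j)`. -/
def traceMetric {V : Type*} [AddCommGroup V] [Module ℝ V] (h : Metric m M) (x : M)
    (B : Fin m → Fin m → V) : V :=
  ∑ i, ∑ j, (gram h x x)⁻¹ i j • B i j

end Coordinates

/-- The differential `dφ_x : T_x M → T_{φ(x)} N`. -/
def dmap (m n : ℕ)
    {M : Type*} [TopologicalSpace M] [ChartedSpace (EuclideanSpace ℝ (Fin m)) M]
    {N : Type*} [TopologicalSpace N] [ChartedSpace (EuclideanSpace ℝ (Fin n)) N]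
    (φ : M → N) (x : M) : TangentSpace (𝓡 m) x →L[ℝ] TangentSpace (𝓡 n) (φ x) :=
  mfderiv (𝓡 m) (𝓡 n) φ x

section Maps

variable {m n : ℕ}
  {M : Type*} [TopologicalSpace M] [ChartedSpace (EuclideanSpace ℝ (Fin m)) M]
  {N : Type*} [TopologicalSpace N] [ChartedSpace (EuclideanSpace ℝ (Fin n)) N]

variable [IsManifold (𝓡 n) ∞ N]

/-- The covariant derivative `∇_X V ∈ T_{φ(x)} N` of a section `V` of `φ^* TN` in the direction
`X ∈ T_x M`, for the connection on `φ^* TN` induced by the Levi-Civita connection of `(N, g)`: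
`(∇_X V)^k = d(V^k)(X) + Γ^k_{ij}(φ(x)) dφ(X)^i V^j` in the chart of `N` around `φ(x)`. -/
def pullbackCov (g : Metric n N) (φ : M → N) (V : ∀ y : M, TangentSpace (𝓡 n) (φ y))
    (x : M) (X : TangentSpace (𝓡 m) x) : TangentSpace (𝓡 n) (φ x) :=
  ∑ k, (mvfderiv (𝓡 m) (fun y : M => comp (φ x) (φ y) (V y) k) x X
      + ∑ i, ∑ j, christoffel g (φ x) (φ x) k i j
          * comp (φ x) (φ x) (dmap m n φ x X) i * comp (φ x) (φ x) (V x) j)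
    • coordVec (φ x) (φ x) k

variable [IsManifold (𝓡 m) ∞ M]

/-- The second fundamental form `∇dφ` at `x` on the coordinate vectors of the chart around `x`:
`(∇dφ)(∂_α, ∂_β) = ∇_{∂_α} (dφ(∂_β)) - dφ(∇_{∂_α} ∂_β)`, where
`∇_{∂_α} ∂_β = Γ^γ_{αβ} ∂_γ` for the Levi-Civita connection of `(M, h)`. -/
def secondFundForm (h : Metric m M) (g : Metric n N) (φ : M → N) (x : M) (α β : Fin m) :
    TangentSpace (𝓡 n) (φ x) :=
  pullbackCov g φ (fun y : M => dmap m n φ y (coordVec x y β)) x (coordVec x x α)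
    - dmap m n φ x (∑ γ, christoffel h x x γ α β • coordVec x x γ)

/-- The tension field `τ(φ) = Tr_h ∇dφ`, a section of `φ^* TN`. -/
def tension (h : Metric m M) (g : Metric n N) (φ : M → N) (x : M) : TangentSpace (𝓡 n) (φ x) :=
  traceMetric h x (secondFundForm h g φ x)

/-- The covariant derivative `∇_X τ(φ)` of the tension field. -/
def covTension (h : Metric m M) (g : Metric n N) (φ : M → N) (x : M) (X : TangentSpace (𝓡 m) x) :
    TangentSpace (𝓡 n) (φ x) :=
  pullbackCov g φ (tension h g φ) x X

/-- `|dφ|^2 = h^{αβ} ⟨dφ(∂_α), dφ(∂_β)⟩`. -/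
def normSqDmap (h : Metric m M) (g : Metric n N) (φ : M → N) (x : M) : ℝ :=
  traceMetric h x fun α β =>
    g.inner (φ x) (dmap m n φ x (coordVec x x α)) (dmap m n φ x (coordVec x x β))

/-- `⟨dφ, ∇τ(φ)⟩ = h^{αβ} ⟨dφ(∂_α), ∇_{∂_β} τ(φ)⟩`. -/
def innerDmapCovTension (h : Metric m M) (g : Metric n N) (φ : M → N) (x : M) : ℝ :=
  traceMetric h x fun α β =>
    g.inner (φ x) (dmap m n φ x (coordVec x x α)) (covTension h g φ x (coordVec x x β))

/-- The energy-momentum tensor `T(X, Y)` at `x` of the functional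
`E_{δ₁,δ₂}(φ) = δ₁ ∫ |dφ|² dV + δ₂ ∫ |τ(φ)|² dV`. -/
def energyMomentum (δ₁ δ₂ : ℝ) (h : Metric m M) (g : Metric n N) (φ : M → N) (x : M)
    (X Y : TangentSpace (𝓡 m) x) : ℝ :=
  δ₁ * (g.inner (φ x) (dmap m n φ x X) (dmap m n φ x Y)
      - (1 / 2) * normSqDmap h g φ x * h.inner x X Y)
  + δ₂ * ((1 / 2) * g.inner (φ x) (tension h g φ x) (tension h g φ x) * h.inner x X Y
      + innerDmapCovTension h g φ x * h.inner x X Y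
      - g.inner (φ x) (dmap m n φ x X) (covTension h g φ x Y)
      - g.inner (φ x) (dmap m n φ x Y) (covTension h g φ x X))

/-- A map is harmonic if its tension field vanishes identically. -/
def IsHarmonic (h : Metric m M) (g : Metric n N) (φ : M → N) : Prop :=
  ∀ x : M, tension h g φ x = 0

end Maps

end SemiBiharmonic

end

/-!
The energy-momentum tensor vanishes, hence so does its trace `∑ h^{ij} T(∂_i, ∂_j)` at every point.
The coordinate vectors of a chart are linearly independent and `h` is positive definite, so the
Gram matrix is invertible and the trace of `h` itself is the dimension `m`. Therefore
(`traceMetric_energyMomentum`)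
`Tr T = δ₁ (1 - m / 2) |dφ|² + δ₂ ((m / 2) |τ|² + (m - 2) ⟨dφ, ∇τ⟩)`.
For `m = 2` the terms in `|dφ|²` and in `⟨dφ, ∇τ⟩` drop out and `Tr T = δ₂ |τ|²`. As `δ₂ ≠ 0` and
`g` is positive definite, `τ = 0`. The argument is pointwise, so that no equation has to be
integrated and `M` may be noncompact.
-/

namespace SemiBiharmonic

section Metric

variable {m : ℕ} {M : Type*} [TopologicalSpace M] [ChartedSpace (EuclideanSpace ℝ (Fin m)) M]
  [IsManifold (𝓡 m) ∞ M]

theorem linearIndependent_coordVec (x : M) : LinearIndependent ℝ (coordVec (m := m) x x) := by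
  have hinv : (mvfderiv (𝓡 m) (fun z : M => extChartAt (𝓡 m) x z) x).IsInvertible :=
    isInvertible_mfderiv_extChartAt (mem_extChartAt_source x)
  have hbasis : LinearIndependent ℝ
      (fun i : Fin m => (EuclideanSpace.single i 1 : EuclideanSpace ℝ (Fin m))) := by
    have hfun : (fun i : Fin m => (EuclideanSpace.single i 1 : EuclideanSpace ℝ (Fin m))) =
        (EuclideanSpace.basisFun (Fin m) ℝ).toBasis := by
      ext1 i
      simp
    rw [hfun]
    exact (EuclideanSpace.basisFun (Fin m) ℝ).toBasis.linearIndependent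
  exact hbasis.map_injOn
    (mvfderiv (𝓡 m) (fun z : M => extChartAt (𝓡 m) x z) x).inverse.toLinearMap
    hinv.inverse.injective.injOn

theorem isUnit_det_gram (h : Metric m M) (x : M) : IsUnit (gram h x x).det := by
  rw [isUnit_iff_ne_zero]
  intro hdet
  obtain ⟨v, hv, hv0⟩ := Matrix.exists_mulVec_eq_zero_iff.mpr hdet
  set X : TangentSpace (𝓡 m) x := ∑ i, v i • coordVec x x i with hX
  have hXX : h.inner x X X = v ⬝ᵥ (gram h x x).mulVec v := by
    simp only [hX, map_sum, map_smul, sum_apply, smul_apply, dotProduct, Matrix.mulVec, gram,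
      Matrix.of_apply, smul_eq_mul, Finset.mul_sum]
    rw [Finset.sum_comm]
    exact Finset.sum_congr rfl fun i _ => Finset.sum_congr rfl fun j _ => by ring
  have hX0 : X = 0 := by
    by_contra hne
    have := h.pos x X hne
    simp [hXX, hv0] at this
  exact hv (funext (Fintype.linearIndependent_iff.mp (linearIndependent_coordVec x) v hX0))

theorem isSymm_gram (h : Metric m M) (p y : M) : (gram h p y).IsSymm :=
  Matrix.IsSymm.ext fun _ _ => h.symm y _ _

theorem traceMetric_swap {V : Type*} [AddCommGroup V] [Module ℝ V] (h : Metric m M) (x : M)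
    (B : Fin m → Fin m → V) : traceMetric h x (fun i j => B j i) = traceMetric h x B := by
  unfold traceMetric
  rw [Finset.sum_comm]
  refine Finset.sum_congr rfl fun i _ => Finset.sum_congr rfl fun j _ => ?_
  rw [(isSymm_gram h x x).inv.apply]

theorem traceMetric_metric (h : Metric m M) (x : M) :
    traceMetric h x (fun i j => h.inner x (coordVec x x i) (coordVec x x j)) = m := by
  rw [← traceMetric_swap]
  calc _ = ((gram h x x)⁻¹ * gram h x x).trace := by
        simp [traceMetric, Matrix.trace, Matrix.mul_apply, gram]
    _ = m := by simp [Matrix.nonsing_inv_mul _ (isUnit_det_gram h x)]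

section Linearity

variable {V : Type*} [AddCommGroup V] [Module ℝ V] (h : Metric m M) (x : M)

theorem traceMetric_add (A B : Fin m → Fin m → V) :
    traceMetric h x (fun i j => A i j + B i j) = traceMetric h x A + traceMetric h x B := by
  simp [traceMetric, Finset.sum_add_distrib]

theorem traceMetric_sub (A B : Fin m → Fin m → V) :
    traceMetric h x (fun i j => A i j - B i j) = traceMetric h x A - traceMetric h x B := by
  simp [traceMetric, Finset.sum_sub_distrib, smul_sub]

theorem traceMetric_const_mul (c : ℝ) (B : Fin m → Fin m → ℝ) :
    traceMetric h x (fun i j => c * B i j) = c * traceMetric h x B := by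
  simp [traceMetric, Finset.mul_sum, mul_left_comm]

end Linearity

end Metric

/-- The trace of the energy-momentum tensor in dimension `m`. The coefficients of `|dφ|²` and of
`⟨dφ, ∇τ⟩` are multiples of `m - 2`. -/
theorem traceMetric_energyMomentum {m n : ℕ}
    {M : Type*} [TopologicalSpace M] [ChartedSpace (EuclideanSpace ℝ (Fin m)) M]
    [IsManifold (𝓡 m) ∞ M]
    {N : Type*} [TopologicalSpace N] [ChartedSpace (EuclideanSpace ℝ (Fin n)) N]
    [IsManifold (𝓡 n) ∞ N]
    (δ₁ δ₂ : ℝ) (h : Metric m M) (g : Metric n N) (φ : M → N) (x : M) :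
    traceMetric h x
        (fun i j => energyMomentum δ₁ δ₂ h g φ x (coordVec x x i) (coordVec x x j)) =
      δ₁ * ((1 - m / 2) * normSqDmap h g φ x)
      + δ₂ * (m / 2 * g.inner (φ x) (tension h g φ x) (tension h g φ x)
        + (m - 2) * innerDmapCovTension h g φ x) := by
  have hswap : traceMetric h x (fun i j => g.inner (φ x) (dmap m n φ x (coordVec x x j))
      (covTension h g φ x (coordVec x x i))) = innerDmapCovTension h g φ x :=
    traceMetric_swap h x fun i j => g.inner (φ x) (dmap m n φ x (coordVec x x i))
      (covTension h g φ x (coordVec x x j))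
  simp only [energyMomentum, traceMetric_add, traceMetric_sub, traceMetric_const_mul,
    traceMetric_metric, hswap]
  rw [← normSqDmap, ← innerDmapCovTension]
  ring

end SemiBiharmonic

theorem mainTheorem8 {n : ℕ}
    {M : Type*} [TopologicalSpace M] [ChartedSpace (EuclideanSpace ℝ (Fin 2)) M]
    [IsManifold (𝓡 2) ∞ M]
    {N : Type*} [TopologicalSpace N] [ChartedSpace (EuclideanSpace ℝ (Fin n)) N]
    [IsManifold (𝓡 n) ∞ N]
    (h : SemiBiharmonic.Metric 2 M) (g : SemiBiharmonic.Metric n N)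
    (δ₁ δ₂ : ℝ) (hδ₂ : δ₂ ≠ 0)
    (φ : M → N) (hφ : ContMDiff (𝓡 2) (𝓡 n) ∞ φ)
    (hT : ∀ (x : M) (X Y : TangentSpace (𝓡 2) x),
      SemiBiharmonic.energyMomentum δ₁ δ₂ h g φ x X Y = 0) :
    SemiBiharmonic.IsHarmonic h g φ := by
  intro x
  -- The trace of `T` at `x` is `δ₂ |τ|²`, positive up to the nonzero factor `δ₂` unless `τ = 0`.
  by_contra hne
  have hpos := g.pos (φ x) _ hne
  have htr := SemiBiharmonic.traceMetric_energyMomentum δ₁ δ₂ h g φ x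
  simp only [hT, SemiBiharmonic.traceMetric, smul_zero, Finset.sum_const_zero] at htr
  norm_num at htr
  exact htr.elim hδ₂ hpos.ne'
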